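/- Consider a game with players $i=1,\dots,N$, action sets $\mathbb{R}^{n_i}$ and cost functions $J_i:\mathbb{R}^n\to\mathbb{R}$, $n=\sum_i n_i$, where $x=(x_1,\dots,x_N)=(x_i,x_{-i})$ denotes the action profile. Suppose that for every $i$ the cost $J_i$ is $C^1$ on $\mathbb{R}^n$ and that, for every fixed $x_{-i}$, the function $x_i\mapsto J_i(x_i,x_{-i})$ is convex and radially unbounded, i.e. $J_i(x_i,x_{-i})\to+\infty$ as $\|x_i\|\to\infty$. Suppose that the pseudo-gradient $F(x)=(\nabla_{x_1}J_1(x),\dots,\nabla_{x_N}J_N(x))$ is monotone, i.e. $\langle F(x)-F(y),x-y\rangle\ge 0$ for all $x,y\in\mathbb{R}^n$, and that the game has at least one Nash equilibrium, i.e. a point $x^*$ with $J_i(x^*)\le J_i(y_i,x^*_{-i})$ for all $i$ and all $y_i\in\mathbb{R}^{n_i}$. Then the set of Nash equilibria is $\{x^*: F(x^*)=0\}$, and for all $\alpha,\beta>0$ the set $S=\{(x^*,x^*): F(x^*)=0\}$ is globally asymptotically stable for the Heavy Anchor dynamics $$\dot r=\alpha(x-r),\qquad \dot x=-F(x)-\beta(x-r)$$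 in the state $(x,r)\in\mathbb{R}^n\times\mathbb{R}^n$. That is: from every initial state there is a solution on $[0,\infty)$, and every solution on a finite interval $[0,T)$ extends to a solution on $[0,\infty)$; for every $\varepsilon>0$ there is $\delta>0$ such that every solution on $[0,\infty)$ whose initial state has distance less than $\delta$ to $S$ stays at distance less than $\varepsilon$ from $S$ for all $t\ge 0$; and the distance to $S$ of every solution on $[0,\infty)$ tends to $0$ as $t\to\infty$. -/

import Mathlib

open Set Filter Topology

noncomputable section

namespace HeavyAnchor

/-- The space of action profiles `x = (x_1, …, x_N)` with `x_i ∈ ℝ^(n i)`, i.e. `ℝ^(n_1 + ⋯ + n_N)`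
in block form, with its Euclidean norm and inner product. -/
abbrev Profile {N : ℕ} (n : Fin N → ℕ) : Type :=
  PiLp 2 (fun i : Fin N => EuclideanSpace ℝ (Fin (n i)))

variable {N : ℕ} {n : Fin N → ℕ}

/-- The profile `(y, x_{-i})`: player `i` plays `y`, all others play as in `x`. -/
def deviate (x : Profile n) (i : Fin N) (y : EuclideanSpace ℝ (Fin (n i))) : Profile n :=
  WithLp.toLp 2 (Function.update x.ofLp i y)

/-- `x` is a Nash equilibrium of the game with costs `J i` and action sets `ℝ^(n i)`. -/
def IsNashEquilibrium (J : Fin N → Profile n → ℝ) (x : Profile n) : Prop :=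
  ∀ (i : Fin N) (y : EuclideanSpace ℝ (Fin (n i))), J i x ≤ J i (deviate x i y)

/-- The pseudo-gradient `F(x) = (∇_{x_1} J_1(x), …, ∇_{x_N} J_N(x))`. -/
def pseudoGradient (J : Fin N → Profile n → ℝ) (x : Profile n) : Profile n :=
  WithLp.toLp 2 (fun i => gradient (fun y => J i (deviate x i y)) (x i))

/-- Each cost is jointly `C¹`, and convex and radially unbounded in the player's own action, for all
actions of the other players. -/
structure IsRegularGame (J : Fin N → Profile n → ℝ) : Prop where
  contDiff : ∀ i, ContDiff ℝ 1 (J i)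
  convex : ∀ i (x : Profile n), ConvexOn ℝ univ (fun y => J i (deviate x i y))
  radiallyUnbounded : ∀ i (x : Profile n),
    Tendsto (fun y => J i (deviate x i y)) (Bornology.cobounded _) atTop

/-- A (single-valued) monotone operator on a real inner product space. -/
def IsMonotoneOperator {E : Type*} [NormedAddCommGroup E] [InnerProductSpace ℝ E]
    (T : E → E) : Prop :=
  ∀ x y, 0 ≤ inner ℝ (T x - T y) (x - y)

/-- The vector field of the dynamics `ẋ = -F(x) - β (x - r)`, `ṙ = α (x - r)` at the state
`(x, r)`. -/
def vectorField (J : Fin N → Profile n → ℝ) (α β : ℝ) (z : Profile n × Profile n) :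
    Profile n × Profile n :=
  (-pseudoGradient J z.1 - β • (z.1 - z.2), α • (z.1 - z.2))

section Dynamics

variable {E : Type*} [NormedAddCommGroup E] [NormedSpace ℝ E]

/-- `γ` solves `γ' = f(γ)` on the interval `I` (with one-sided derivatives at end points in `I`). -/
def IsSolutionOn (f : E → E) (γ : ℝ → E) (I : Set ℝ) : Prop :=
  ∀ t ∈ I, HasDerivWithinAt γ (f (γ t)) I t

/-- The nonempty set `S` is globally asymptotically stable for `z' = f(z)`. Since `f` need not be
locally Lipschitz, forward completeness is spelled out, and stability and attraction are required
of all solutions. -/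
structure IsGloballyAsymptoticallyStable (f : E → E) (S : Set E) : Prop where
  nonempty : S.Nonempty
  /-- From every state there starts a solution on `[0, ∞)`. -/
  exists_solution : ∀ z : E, ∃ γ : ℝ → E, γ 0 = z ∧ IsSolutionOn f γ (Ici 0)
  /-- No solution is confined to a finite time interval. -/
  extends_forever : ∀ (T : ℝ) (γ : ℝ → E), 0 < T → IsSolutionOn f γ (Ico 0 T) →
    ∃ γ' : ℝ → E, IsSolutionOn f γ' (Ici 0) ∧ EqOn γ' γ (Ico 0 T)
  /-- Lyapunov stability of the set. -/
  stable : ∀ ε > 0, ∃ δ > 0, ∀ γ : ℝ → E, IsSolutionOn f γ (Ici 0) →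
    Metric.infDist (γ 0) S < δ → ∀ t ≥ 0, Metric.infDist (γ t) S < ε
  /-- Global attraction. -/
  attractive : ∀ γ : ℝ → E, IsSolutionOn f γ (Ici 0) →
    Tendsto (fun t => Metric.infDist (γ t) S) atTop (𝓝 0)

end Dynamics

end HeavyAnchor

end

/-! Convexity turns the Nash condition into `F x = 0`. For the dynamics, replace `r` by `s = √(β/α)
r`. In the coordinates `(x, s)` the difference of the field at two points, paired with the
difference `(dx, ds)` of the points, equals `-⟨dF, dx⟩ - ‖√β dx - √α ds‖²`
(`inner_scaledField_sub`), which is nonpositive. Hence the distance between any two solutions is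
nonincreasing (`IsDissipative.norm_sub_le`). This contraction yields uniqueness, stability of the
zero set and bounded orbits.

Since `F` is only continuous, existence is proved by smooth approximation: contraction makes the
approximate solutions Cauchy (`IsDissipative.exists_solution_Icc`).

Attraction is a LaSalle argument (`IsDissipative.tendsto_infDist`). A solution starting at a limit
point of an orbit keeps a constant distance to a given equilibrium, so the square above vanishes
along it. Then `s` is constant, `x` is proportional to `s` and so constant, and `F x = 0`. The
result returns to the original coordinates through `IsGloballyAsymptoticallyStable.of_conj`. -/

noncomputable section

namespace HeavyAnchor

/-! ### Dissipative fields: contraction, existence of solutions, invariance principle. -/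

section Dissipative

variable {H : Type*} [NormedAddCommGroup H] [InnerProductSpace ℝ H]

lemma norm_sq_le_of_inner_deriv_le {y v : ℝ → H} {D : Set ℝ} (hD : Convex ℝ D) {c : ℝ}
    (hy : ∀ t ∈ D, HasDerivWithinAt y (v t) D t) (hv : ∀ t ∈ D, inner ℝ (y t) (v t) ≤ c)
    {s t : ℝ} (hs : s ∈ D) (ht : t ∈ D) (hst : s ≤ t) :
    ‖y t‖ ^ 2 ≤ ‖y s‖ ^ 2 + 2 * c * (t - s) := by
  have hderiv : ∀ u ∈ D, HasDerivWithinAt (fun u => ‖y u‖ ^ 2 - 2 * c * u)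
      (2 * inner ℝ (y u) (v u) - 2 * c) D u := fun u hu => by
    have h := (hy u hu).norm_sq.sub ((hasDerivWithinAt_id u D).const_mul (2 * c))
    rw [mul_one] at h
    exact h
  have h := antitoneOn_of_hasDerivWithinAt_nonpos hD
    (fun u hu => (hderiv u hu).continuousWithinAt)
    (fun u hu => (hderiv u (interior_subset hu)).mono interior_subset)
    (fun u hu => by linarith [hv u (interior_subset hu)]) hs ht hst
  simp only at h
  linarith

/-- A vector field whose flow contracts distances to first order. -/
def IsDissipative (f : H → H) : Prop := ∀ x y, inner ℝ (f x - f y) (x - y) ≤ 0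

lemma IsDissipative.norm_sub_le {f : H → H} (hf : IsDissipative f) {γ η : ℝ → H} {D : Set ℝ}
    (hD : Convex ℝ D) (hγ : IsSolutionOn f γ D) (hη : IsSolutionOn f η D)
    {s t : ℝ} (hs : s ∈ D) (ht : t ∈ D) (hst : s ≤ t) : ‖γ t - η t‖ ≤ ‖γ s - η s‖ := by
  have h := norm_sq_le_of_inner_deriv_le (c := 0) (y := fun t => γ t - η t) hD
    (fun t ht => (hγ t ht).sub (hη t ht))
    (fun t _ => by rw [real_inner_comm]; exact hf _ _) hs ht hst
  simp only [mul_zero, zero_mul, add_zero] at h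
  exact le_of_sq_le_sq h (norm_nonneg _)

lemma isSolutionOn_const {f : H → H} {z : H} (hz : f z = 0) (D : Set ℝ) :
    IsSolutionOn f (fun _ => z) D := fun t _ => by
  rw [hz]; exact hasDerivWithinAt_const t D z

/-- Pointwise convergence is enough because the `y k` share the Lipschitz constant `L`: near `s`
they all remain close to `γ s`, so their velocities are nearly `f (γ s)`. The mean value inequality
for `y k t - t • f (γ s)` then passes to the limit. -/
lemma isSolutionOn_of_tendsto {f : H → H} (hf : Continuous f) {T L : ℝ} {y v : ℕ → ℝ → H}
    {γ : ℝ → H} {ε : ℕ → ℝ} (hε : Tendsto ε atTop (𝓝 0))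
    (hy : ∀ k, ∀ t ∈ Icc 0 T, HasDerivWithinAt (y k) (v k t) (Icc 0 T) t)
    (hv : ∀ k, ∀ t ∈ Icc 0 T, ‖v k t - f (y k t)‖ ≤ ε k)
    (hL : ∀ k, ∀ t ∈ Icc 0 T, ‖v k t‖ ≤ L)
    (hγ : ∀ t ∈ Icc 0 T, Tendsto (fun k => y k t) atTop (𝓝 (γ t))) :
    IsSolutionOn f γ (Icc 0 T) := by
  intro s hs
  rw [hasDerivWithinAt_iff_isLittleO, Asymptotics.isLittleO_iff]
  intro η hη
  obtain ⟨δ, hδ, hfδ⟩ := Metric.continuous_iff.1 hf (γ s) (η / 2) (by positivity)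
  have hL0 : 0 ≤ L := (norm_nonneg _).trans (hL 0 s hs)
  have hρ : 0 < δ / (2 * (L + 1)) := by positivity
  -- The radius is such that a curve of speed at most `L` moves by at most `δ / 2`; the other `δ /
  -- 2` is for the convergence at `s`.
  filter_upwards [self_mem_nhdsWithin, mem_nhdsWithin_of_mem_nhds (Metric.ball_mem_nhds s hρ)]
    with t ht htρ
  have hconv : Convex ℝ (Icc 0 T ∩ Metric.ball s (δ / (2 * (L + 1)))) :=
    (convex_Icc 0 T).inter (convex_ball _ _)
  have hlim : Tendsto (fun k => ‖(y k t - t • f (γ s)) - (y k s - s • f (γ s))‖) atTop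
      (𝓝 ‖(γ t - t • f (γ s)) - (γ s - s • f (γ s))‖) :=
    (((hγ t ht).sub_const _).sub ((hγ s hs).sub_const _)).norm
  have hkey : ‖(γ t - t • f (γ s)) - (γ s - s • f (γ s))‖ ≤ η * ‖t - s‖ := by
    refine le_of_tendsto hlim ?_
    filter_upwards [(Metric.tendsto_nhds.1 (hγ s hs)) (δ / 2) (by positivity),
      hε.eventually (gt_mem_nhds (half_pos hη))] with k hk hεk
    refine Convex.norm_image_sub_le_of_norm_hasDerivWithin_le
      (f := fun t => y k t - t • f (γ s)) (f' := fun t => v k t - f (γ s))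
      (fun τ hτ => ?_) (fun τ hτ => ?_) hconv ⟨hs, Metric.mem_ball_self hρ⟩ ⟨ht, htρ⟩
    · have := ((hy k τ hτ.1).mono inter_subset_left).sub
        ((hasDerivWithinAt_id τ (Icc 0 T ∩ Metric.ball s (δ / (2 * (L + 1))))).smul_const (f (γ s)))
      rw [one_smul] at this
      exact this
    · have h1 : ‖y k τ - y k s‖ ≤ L * ‖τ - s‖ :=
        Convex.norm_image_sub_le_of_norm_hasDerivWithin_le (hy k) (hL k) (convex_Icc 0 T) hs hτ.1
      have h2 : ‖τ - s‖ < δ / (2 * (L + 1)) := by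
        rw [← dist_eq_norm]; exact hτ.2
      have h3 : L * ‖τ - s‖ ≤ δ / 2 := by
        calc L * ‖τ - s‖ ≤ (L + 1) * (δ / (2 * (L + 1))) := by gcongr; linarith
          _ = δ / 2 := by field_simp
      have h4 : dist (y k τ) (γ s) < δ := by
        calc dist (y k τ) (γ s) ≤ dist (y k τ) (y k s) + dist (y k s) (γ s) := dist_triangle _ _ _
          _ < δ := by rw [dist_eq_norm]; linarith
      have h5 := hfδ _ h4
      rw [dist_eq_norm] at h5
      calc ‖v k τ - f (γ s)‖ = ‖(v k τ - f (y k τ)) + (f (y k τ) - f (γ s))‖ := by abel_nf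
        _ ≤ η := by linarith [norm_add_le (v k τ - f (y k τ)) (f (y k τ) - f (γ s)), hv k τ hτ.1]
  convert hkey using 2
  rw [sub_smul]; abel

lemma IsSolutionOn.comp_const_add {f : H → H} {γ : ℝ → H} (hγ : IsSolutionOn f γ (Ici 0)) {τ : ℝ}
    (hτ : 0 ≤ τ) : IsSolutionOn f (fun s => γ (τ + s)) (Ici 0) := fun t ht => by
  have ht' : (0 : ℝ) ≤ t := ht
  have h1 : HasDerivWithinAt (fun s : ℝ => τ + s) 1 (Ici 0) t :=
    (hasDerivWithinAt_id t (Ici 0)).const_add τ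
  have h2 := (hγ (τ + t) (by simp only [mem_Ici]; linarith)).scomp t h1
    (fun s hs => by simp only [mem_Ici] at hs ⊢; linarith)
  rw [one_smul] at h2
  exact h2

/-- Each zero of `f` is a constant solution, so contraction applies to it and the infimum over zeros
inherits the monotonicity. -/
lemma IsDissipative.infDist_antitone {f : H → H} (hf : IsDissipative f) {γ : ℝ → H}
    (hγ : IsSolutionOn f γ (Ici 0)) {z₀ : H} (hz₀ : f z₀ = 0) {s t : ℝ} (hs : 0 ≤ s)
    (hst : s ≤ t) :
    Metric.infDist (γ t) {z | f z = 0} ≤ Metric.infDist (γ s) {z | f z = 0} := by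
  refine (Metric.le_infDist ⟨z₀, hz₀⟩).2 fun w hw => ?_
  refine (Metric.infDist_le_dist_of_mem hw).trans ?_
  rw [dist_eq_norm, dist_eq_norm]
  exact hf.norm_sub_le (convex_Ici 0) hγ (isSolutionOn_const hw _) hs
    (mem_Ici.2 (hs.trans hst)) hst

variable [FiniteDimensional ℝ H]

/-- A bounded, uniformly continuous field has approximate solutions on every interval. -/
lemma exists_approx_solution {f : H → H} (hf : UniformContinuous f) {C : ℝ} (hC : ∀ x, ‖f x‖ ≤ C)
    (z : H) {T ε : ℝ} (hT : 0 ≤ T) (hε : 0 < ε) :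
    ∃ y v : ℝ → H, y 0 = z ∧ ∀ t ∈ Icc 0 T,
      HasDerivWithinAt y (v t) (Icc 0 T) t ∧ ‖v t - f (y t)‖ ≤ ε := by
  obtain ⟨g, hg, hgf⟩ := hf.exists_contDiff_dist_le hε
  have hC0 : 0 ≤ C := (norm_nonneg _).trans (hC z)
  -- The smooth approximation `g` has speed at most `C + ε`, so `(C + ε) * T` is a radius that
  -- cannot be left within time `T`, and Picard–Lindelöf covers the whole interval.
  let L : NNReal := ⟨C + ε, by positivity⟩
  let a : NNReal := ⟨(C + ε) * T, by positivity⟩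
  obtain ⟨K, hK⟩ := hg.contDiffOn.exists_lipschitzOnWith (by simp)
    (convex_closedBall z a) (isCompact_closedBall z a)
  have hPL : IsPicardLindelof (fun _ => g) (⟨0, left_mem_Icc.2 hT⟩ : Icc (0 : ℝ) T) z a 0 L K :=
    { lipschitzOnWith := fun _ _ => hK
      continuousOn := fun _ _ => continuousOn_const
      norm_le := fun _ _ x _ => by
        have h1 := (hgf x).le
        rw [dist_eq_norm] at h1
        calc ‖g x‖ = ‖f x + (g x - f x)‖ := by abel_nf
          _ ≤ C + ε := (norm_add_le _ _).trans (add_le_add (hC x) h1)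
      mul_max_le := by
        have h : max (T - (0 : ℝ)) (0 - 0) = T := by simp [hT]
        change (C + ε) * max (T - 0) (0 - 0) ≤ (C + ε) * T - 0
        rw [h, sub_zero] }
  obtain ⟨y, hy0, hy⟩ := hPL.exists_eq_forall_mem_Icc_hasDerivWithinAt₀
  exact ⟨y, fun t => g (y t), hy0, fun t ht =>
    ⟨hy t ht, by rw [← dist_eq_norm]; exact (hgf _).le⟩⟩

/-- Existence on compact intervals for a continuous dissipative field with a zero. -/
lemma IsDissipative.exists_solution_Icc {f : H → H} (hf : IsDissipative f) (hc : Continuous f)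
    {z₀ : H} (hz₀ : f z₀ = 0) (z : H) {T : ℝ} (hT : 0 ≤ T) :
    ∃ γ : ℝ → H, γ 0 = z ∧ IsSolutionOn f γ (Icc 0 T) := by
  set R := ‖z - z₀‖
  -- The cutoff is 1 up to radius `R + 1` and 0 beyond `R + 2`, which makes `χ • f` bounded and
  -- uniformly continuous. As `χ ≥ 0`, this field still does not point away from `z₀`.
  let χ : H → ℝ := fun x => max 0 (min 1 (R + 2 - ‖x - z₀‖))
  have hχc : Continuous χ := by fun_prop
  have hχ0 : ∀ x, 0 ≤ χ x := fun x => le_max_left _ _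
  have hχ1 : ∀ x, ‖x - z₀‖ ≤ R + 1 → χ x = 1 := fun x hx => by
    simp only [χ]
    rw [min_eq_left (by linarith), max_eq_right zero_le_one]
  have hχs : HasCompactSupport χ :=
    HasCompactSupport.intro (isCompact_closedBall z₀ (R + 2)) fun x hx => by
      rw [Metric.mem_closedBall, not_le, dist_eq_norm] at hx
      exact max_eq_left ((min_le_right _ _).trans (by linarith))
  let f' : H → H := fun x => χ x • f x
  have hf'c : Continuous f' := hχc.smul hc
  have hf's : HasCompactSupport f' := hχs.smul_right
  have hdiss : ∀ x, inner ℝ (x - z₀) (f' x) ≤ 0 := fun x => by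
    have h := hf x z₀
    rw [hz₀, sub_zero, real_inner_comm] at h
    simp only [f', inner_smul_right]
    exact mul_nonpos_of_nonneg_of_nonpos (hχ0 x) h
  obtain ⟨C, hC⟩ := hf's.exists_bound_of_continuous hf'c
  have hC0 : 0 ≤ C := (norm_nonneg _).trans (hC z)
  have hu : UniformContinuous f' := hf's.uniformContinuous_of_continuous hf'c
  have hR0 : 0 ≤ R := norm_nonneg _
  let B := R + (C + 1) * T
  have hB : 0 ≤ B := by positivity
  -- `B` is a crude bound on the distance to `z₀`, from speed at most `C + 1`. The factor gives `2 *
  -- ε k * B * T ≤ 1`, hence `‖y k t - z₀‖² ≤ R² + 1 ≤ (R + 1)²`: the approximations never reach the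
  -- region where the cutoff acts.
  let ε : ℕ → ℝ := fun k => (1 / (2 * B * T + 1)) * (1 / ((k : ℝ) + 1))
  have hεpos : ∀ k, 0 < ε k := fun k => by positivity
  have hεlim : Tendsto ε atTop (𝓝 0) := by
    have h := (tendsto_one_div_add_atTop_nhds_zero_nat (𝕜 := ℝ)).const_mul (1 / (2 * B * T + 1))
    rwa [mul_zero] at h
  have hεle : ∀ k, ε k ≤ 1 / (2 * B * T + 1) := fun k => by
    refine mul_le_of_le_one_right (by positivity) ?_
    rw [div_le_one (by positivity)]
    linarith [(Nat.cast_nonneg k : (0 : ℝ) ≤ k)]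
  have hε1 : ∀ k, ε k ≤ 1 := fun k => (hεle k).trans <| by
    rw [div_le_one (by positivity)]; nlinarith [mul_nonneg hB hT]
  have hεB : ∀ k, 2 * (ε k * B) * T ≤ 1 := fun k => by
    calc 2 * (ε k * B) * T = ε k * (2 * B * T) := by ring
      _ ≤ 1 / (2 * B * T + 1) * (2 * B * T) := by gcongr; exact hεle k
      _ ≤ 1 := by rw [one_div_mul_eq_div, div_le_one (by positivity)]; linarith
  choose y v hy0 hy using fun k => exists_approx_solution hu hC z hT (hεpos k)
  have h0 : (0 : ℝ) ∈ Icc 0 T := left_mem_Icc.2 hT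
  have hvL : ∀ k, ∀ t ∈ Icc 0 T, ‖v k t‖ ≤ C + 1 := fun k t ht => by
    calc ‖v k t‖ = ‖f' (y k t) + (v k t - f' (y k t))‖ := by abel_nf
      _ ≤ C + 1 := (norm_add_le _ _).trans
        (add_le_add (hC _) (((hy k t ht).2).trans (hε1 k)))
  have hyB : ∀ k, ∀ t ∈ Icc 0 T, ‖y k t - z₀‖ ≤ B := fun k t ht => by
    have h1 : ‖y k t - y k 0‖ ≤ (C + 1) * ‖t - 0‖ :=
      Convex.norm_image_sub_le_of_norm_hasDerivWithin_le (fun t ht => (hy k t ht).1) (hvL k)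
        (convex_Icc 0 T) h0 ht
    rw [hy0, sub_zero, Real.norm_of_nonneg ht.1] at h1
    have h2 : (C + 1) * t ≤ (C + 1) * T := by gcongr; exact ht.2
    calc ‖y k t - z₀‖ ≤ ‖z - z₀‖ + ‖y k t - z‖ := by
          rw [add_comm]; exact norm_sub_le_norm_sub_add_norm_sub _ _ _
      _ ≤ B := by simp only [B]; linarith
  have hyR : ∀ k, ∀ t ∈ Icc 0 T, ‖y k t - z₀‖ ≤ R + 1 := fun k t ht => by
    have h := norm_sq_le_of_inner_deriv_le (c := ε k * B) (y := fun t => y k t - z₀)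
      (convex_Icc 0 T) (fun t ht => (hy k t ht).1.sub_const z₀) (fun t ht => ?_) h0 ht ht.1
    · have h2 : 2 * (ε k * B) * (t - 0) ≤ 2 * (ε k * B) * T := by
        have := (hεpos k).le
        gcongr; linarith [ht.2]
      simp only [hy0] at h
      refine le_of_sq_le_sq ?_ (by positivity)
      nlinarith [hεB k]
    · calc inner ℝ (y k t - z₀) (v k t)
          = inner ℝ (y k t - z₀) (f' (y k t)) + inner ℝ (y k t - z₀) (v k t - f' (y k t)) := by
            rw [← inner_add_right]; abel_nf
        _ ≤ 0 + ‖y k t - z₀‖ * ‖v k t - f' (y k t)‖ :=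
            add_le_add (hdiss _) (real_inner_le_norm _ _)
        _ ≤ 0 + B * ε k := by
            gcongr
            exacts [hyB k t ht, (hy k t ht).2]
        _ = ε k * B := by ring
  have hyf : ∀ k, ∀ t ∈ Icc 0 T, ‖v k t - f (y k t)‖ ≤ ε k := fun k t ht => by
    have := (hy k t ht).2
    simpa only [f', hχ1 _ (hyR k t ht), one_smul] using this
  -- With the cutoff inactive, dissipativity of `f` itself applies, and only the errors `ε k + ε l`
  -- can separate two approximations.
  have hpair : ∀ k l, ∀ t ∈ Icc 0 T,
      ‖y k t - y l t‖ ^ 2 ≤ 4 * (R + 1) * T * (ε k + ε l) := fun k l t ht => by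
    have h := norm_sq_le_of_inner_deriv_le (c := 2 * (R + 1) * (ε k + ε l))
      (y := fun t => y k t - y l t)
      (convex_Icc 0 T) (fun t ht => (hy k t ht).1.sub (hy l t ht).1) (fun t ht => ?_) h0 ht ht.1
    · simp only [hy0, sub_self, norm_zero] at h
      have h1 := (hεpos k).le
      have h2 := (hεpos l).le
      have h3 : 2 * (2 * (R + 1) * (ε k + ε l)) * (t - 0) ≤
          2 * (2 * (R + 1) * (ε k + ε l)) * T := by
        gcongr; linarith [ht.2]
      linarith
    · have hn : ‖y k t - y l t‖ ≤ 2 * (R + 1) := by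
        calc ‖y k t - y l t‖ = ‖(y k t - z₀) - (y l t - z₀)‖ := by abel_nf
          _ ≤ 2 * (R + 1) := (_root_.norm_sub_le _ _).trans (by linarith [hyR k t ht, hyR l t ht])
      have hm : ‖(v k t - f (y k t)) - (v l t - f (y l t))‖ ≤ ε k + ε l :=
        (_root_.norm_sub_le _ _).trans (add_le_add (hyf k t ht) (hyf l t ht))
      calc inner ℝ (y k t - y l t) (v k t - v l t)
          = inner ℝ (y k t - y l t) (f (y k t) - f (y l t)) +
            inner ℝ (y k t - y l t) ((v k t - f (y k t)) - (v l t - f (y l t))) := by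
            rw [← inner_add_right]; abel_nf
        _ ≤ 0 + ‖y k t - y l t‖ * ‖(v k t - f (y k t)) - (v l t - f (y l t))‖ :=
            add_le_add (by rw [real_inner_comm]; exact hf _ _) (real_inner_le_norm _ _)
        _ ≤ 0 + 2 * (R + 1) * (ε k + ε l) := by gcongr
        _ = _ := by ring
  have hcauchy : ∀ t ∈ Icc 0 T, CauchySeq fun k => y k t := fun t ht => by
    have hp : Tendsto (fun p : ℕ × ℕ => 4 * (R + 1) * T * (ε p.1 + ε p.2)) atTop (𝓝 0) := by
      have h : Tendsto (fun p : ℕ × ℕ => ε p.1 + ε p.2) atTop (𝓝 (0 + 0)) := by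
        rw [← prod_atTop_atTop_eq]
        exact (hεlim.comp tendsto_fst).add (hεlim.comp tendsto_snd)
      simpa using h.const_mul (4 * (R + 1) * T)
    rw [cauchySeq_iff_tendsto_dist_atTop_0]
    have hsq := squeeze_zero (fun p : ℕ × ℕ => sq_nonneg ‖y p.1 t - y p.2 t‖)
      (fun p => hpair p.1 p.2 t ht) hp
    have := hsq.sqrt
    simpa [Real.sqrt_sq, dist_eq_norm] using this
  choose! γ hγ using fun t ht => cauchySeq_tendsto_of_complete (hcauchy t ht)
  refine ⟨γ, ?_, isSolutionOn_of_tendsto hc hεlim (fun k t ht => (hy k t ht).1) hyf hvL hγ⟩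
  have := hγ 0 h0
  simp only [hy0] at this
  exact tendsto_nhds_unique this tendsto_const_nhds

lemma IsDissipative.exists_solution_Ici {f : H → H} (hf : IsDissipative f) (hc : Continuous f)
    {z₀ : H} (hz₀ : f z₀ = 0) (z : H) :
    ∃ γ : ℝ → H, γ 0 = z ∧ IsSolutionOn f γ (Ici 0) := by
  choose γ hγ0 hγ using fun m : ℕ => hf.exists_solution_Icc hc hz₀ z (Nat.cast_nonneg (α := ℝ) m)
  have hmono : ∀ {l m : ℕ}, l ≤ m → ∀ t ∈ Icc (0 : ℝ) l, γ l t = γ m t := fun {l m} hlm t ht => by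
    have hsub : Icc (0 : ℝ) l ⊆ Icc (0 : ℝ) m := Icc_subset_Icc_right (by exact_mod_cast hlm)
    have h := hf.norm_sub_le (convex_Icc 0 (l : ℝ)) (hγ l)
      (fun t ht => (hγ m t (hsub ht)).mono hsub) (left_mem_Icc.2 (Nat.cast_nonneg l)) ht ht.1
    rw [hγ0, hγ0, sub_self, norm_zero] at h
    exact sub_eq_zero.1 (norm_le_zero_iff.1 h)
  refine ⟨fun t => γ ⌈t⌉₊ t, by simp [hγ0], fun t ht => ?_⟩
  -- The extra 1 gives `t < m`, so that `Icc 0 m` is a neighbourhood of `t` within `Ici 0`.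
  set m := ⌈t⌉₊ + 1 with hm
  have htm : t < m := by
    rw [hm]; push_cast; linarith [Nat.le_ceil t]
  have heq : ∀ s ∈ Icc (0 : ℝ) m, γ ⌈s⌉₊ s = γ m s := fun s hs =>
    hmono (Nat.ceil_le.2 hs.2) s ⟨hs.1, Nat.le_ceil s⟩
  have htI : t ∈ Icc (0 : ℝ) m := ⟨ht, htm.le⟩
  have h : HasDerivWithinAt (fun s => γ ⌈s⌉₊ s) (f (γ ⌈t⌉₊ t)) (Icc 0 (m : ℝ)) t := by
    rw [heq t htI]
    exact (hγ m t htI).congr heq (heq t htI)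
  refine h.mono_of_mem_nhdsWithin ?_
  rw [← Ici_inter_Iic]
  exact inter_mem self_mem_nhdsWithin (mem_nhdsWithin_of_mem_nhds (Iic_mem_nhds htm))

/-- LaSalle's principle with Lyapunov function `‖γ t - z₀‖²`: it is constant along the solution
issued from a limit point of the orbit, and `hinv` makes that limit point an equilibrium. -/
lemma IsDissipative.tendsto_infDist {f : H → H} (hf : IsDissipative f)
    (hc : Continuous f) {z₀ : H} (hz₀ : f z₀ = 0)
    (hinv : ∀ ζ : ℝ → H, IsSolutionOn f ζ (Ici 0) →
      (∀ t, 0 ≤ t → inner ℝ (f (ζ t)) (ζ t - z₀) = 0) → f (ζ 0) = 0)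
    {γ : ℝ → H} (hγ : IsSolutionOn f γ (Ici 0)) :
    Tendsto (fun t => Metric.infDist (γ t) {z | f z = 0}) atTop (𝓝 0) := by
  have hz := isSolutionOn_const hz₀ (Ici 0)
  have hanti : ∀ s t : ℝ, 0 ≤ s → s ≤ t → ‖γ t - z₀‖ ≤ ‖γ s - z₀‖ := fun s t hs hst =>
    hf.norm_sub_le (convex_Ici 0) hγ hz hs (mem_Ici.2 (hs.trans hst)) hst
  obtain ⟨w, -, φ, hφ, hw⟩ := (isCompact_closedBall z₀ ‖γ 0 - z₀‖).tendsto_subseq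
    (x := fun k : ℕ => γ k) fun k => by
      rw [Metric.mem_closedBall, dist_eq_norm]
      exact hanti 0 k le_rfl (Nat.cast_nonneg k)
  have hφt : Tendsto (fun k => (φ k : ℝ)) atTop atTop :=
    tendsto_natCast_atTop_atTop.comp hφ.tendsto_atTop
  obtain ⟨ζ, hζ0, hζ⟩ := hf.exists_solution_Ici hc hz₀ w
  -- Clamping by `max 0 t` makes the distance antitone on all of `ℝ`, since `γ` is uncontrolled at
  -- negative times.
  obtain ⟨l, hl⟩ : ∃ l, Tendsto (fun t : ℝ => ‖γ (max 0 t) - z₀‖) atTop (𝓝 l) :=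
    ⟨_, tendsto_atTop_ciInf (fun s t hst => hanti _ _ (le_max_left _ _) (max_le_max_left _ hst))
      ⟨0, by rintro _ ⟨t, rfl⟩; exact norm_nonneg _⟩⟩
  -- Contraction between the time-shifted orbit and `ζ` plays the role of continuous dependence on
  -- initial data.
  have hshift : ∀ s, 0 ≤ s → Tendsto (fun k => γ (φ k + s)) atTop (𝓝 (ζ s)) := fun s hs => by
    rw [tendsto_iff_norm_sub_tendsto_zero]
    refine squeeze_zero (fun _ => norm_nonneg _) (fun k => ?_)
      (tendsto_iff_norm_sub_tendsto_zero.1 hw)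
    have h := hf.norm_sub_le (convex_Ici 0) (hγ.comp_const_add (Nat.cast_nonneg (φ k))) hζ
      (mem_Ici.2 le_rfl) (mem_Ici.2 hs) hs
    simpa [hζ0] using h
  have hnorm : ∀ s, 0 ≤ s → ‖ζ s - z₀‖ = l := fun s hs => by
    have h1 := ((hshift s hs).sub_const z₀).norm
    have h2 := hl.comp (tendsto_atTop_add_const_right _ s hφt)
    refine tendsto_nhds_unique (h1.congr fun k => ?_) h2
    have : (0 : ℝ) ≤ φ k + s := by positivity
    simp [max_eq_right this]
  have hwz : f w = 0 := by
    rw [← hζ0]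
    refine hinv ζ hζ fun t ht => ?_
    have h1 : HasDerivWithinAt (fun s => ‖ζ s - z₀‖ ^ 2)
        (2 * inner ℝ (ζ t - z₀) (f (ζ t))) (Ici 0) t := ((hζ t ht).sub_const z₀).norm_sq
    have h2 : HasDerivWithinAt (fun s => ‖ζ s - z₀‖ ^ 2) 0 (Ici 0) t :=
      (hasDerivWithinAt_const t (Ici 0) (l ^ 2)).congr
        (fun s hs => by rw [hnorm s hs]) (by rw [hnorm t ht])
    have h3 := (uniqueDiffOn_Ici (0 : ℝ) t ht).eq_deriv _ h1 h2
    rw [real_inner_comm]; linarith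
  -- One time at which the orbit is `ε`-close to `w` suffices, because the distance to the zero set
  -- never increases afterwards.
  rw [Metric.tendsto_atTop]
  intro ε hε
  obtain ⟨k, hk⟩ := ((Metric.tendsto_nhds.1 hw) ε hε).exists
  refine ⟨φ k, fun t ht => ?_⟩
  rw [Real.dist_eq, sub_zero, abs_of_nonneg Metric.infDist_nonneg]
  have hwS : w ∈ {z | f z = 0} := hwz
  exact (hf.infDist_antitone hγ hz₀ (Nat.cast_nonneg _) ht).trans_lt
    ((Metric.infDist_le_dist_of_mem hwS).trans_lt hk)

/-- Invariance principle for dissipative fields: if only equilibria carry a solution along which the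
distance to a given equilibrium is stationary, the equilibrium set is globally asymptotically
stable. -/
theorem IsDissipative.isGloballyAsymptoticallyStable {f : H → H} (hf : IsDissipative f)
    (hc : Continuous f) {z₀ : H} (hz₀ : f z₀ = 0)
    (hinv : ∀ ζ : ℝ → H, IsSolutionOn f ζ (Ici 0) →
      (∀ t, 0 ≤ t → inner ℝ (f (ζ t)) (ζ t - z₀) = 0) → f (ζ 0) = 0) :
    IsGloballyAsymptoticallyStable f {z | f z = 0} where
  nonempty := ⟨z₀, hz₀⟩
  exists_solution z := hf.exists_solution_Ici hc hz₀ z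
  extends_forever T γ hT hγ := by
    obtain ⟨γ', h0, hγ'⟩ := hf.exists_solution_Ici hc hz₀ (γ 0)
    refine ⟨γ', hγ', fun t ht => ?_⟩
    -- Contraction from a common initial point is uniqueness, so the global solution extends the
    -- given one.
    have h := hf.norm_sub_le (convex_Ico 0 T)
      (fun t ht => (hγ' t ht.1).mono Ico_subset_Ici_self) hγ (left_mem_Ico.2 hT) ht ht.1
    rw [h0, sub_self, norm_zero] at h
    exact sub_eq_zero.1 (norm_le_zero_iff.1 h)
  stable ε hε := ⟨ε, hε, fun γ hγ h0 t ht =>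
    (hf.infDist_antitone hγ hz₀ le_rfl ht).trans_lt h0⟩
  attractive γ hγ := hf.tendsto_infDist hc hz₀ hinv hγ

end Dissipative

/-! ### Transfer of stability along linear isomorphisms. -/

section Transfer

lemma infDist_image_le {E E' : Type*} [PseudoMetricSpace E] [PseudoMetricSpace E']
    {φ : E → E'} {K : NNReal} (hφ : LipschitzWith K φ) {S : Set E} {S' : Set E'}
    (hS : S.Nonempty) (hm : MapsTo φ S S') (z : E) :
    Metric.infDist (φ z) S' ≤ K * Metric.infDist z S := by
  refine le_of_forall_pos_le_add fun ε hε => ?_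
  -- `K` may be 0, so division is by `K + 1`.
  have hK : (0 : ℝ) < K + 1 := by positivity
  obtain ⟨w, hw, hzw⟩ := (Metric.infDist_lt_iff hS).1
    (lt_add_of_pos_right (Metric.infDist z S) (div_pos hε hK))
  calc Metric.infDist (φ z) S' ≤ dist (φ z) (φ w) := Metric.infDist_le_dist_of_mem (hm hw)
    _ ≤ K * dist z w := hφ.dist_le_mul _ _
    _ ≤ K * (Metric.infDist z S + ε / (K + 1)) := by gcongr
    _ = K * Metric.infDist z S + ε * (K / (K + 1)) := by ring
    _ ≤ K * Metric.infDist z S + ε := by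
      gcongr
      exact mul_le_of_le_one_right hε.le ((div_le_one hK).2 (by linarith))

variable {E E' : Type*} [NormedAddCommGroup E] [NormedSpace ℝ E] [NormedAddCommGroup E']
  [NormedSpace ℝ E']

lemma IsSolutionOn.map {f : E → E} {g : E' → E'} (Φ : E →L[ℝ] E') (h : ∀ z, g (Φ z) = Φ (f z))
    {γ : ℝ → E} {I : Set ℝ} (hγ : IsSolutionOn f γ I) : IsSolutionOn g (fun t => Φ (γ t)) I :=
  fun t ht => by
    rw [h]
    exact Φ.hasFDerivAt.comp_hasDerivWithinAt t (hγ t ht)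

/-- Global asymptotic stability is invariant under linear changes of coordinates. -/
theorem IsGloballyAsymptoticallyStable.of_conj {f : E → E} {g : E' → E'} {S : Set E} {S' : Set E'}
    (Φ : E ≃L[ℝ] E') (h : ∀ z, g (Φ z) = Φ (f z)) (hS : ∀ z, Φ z ∈ S' ↔ z ∈ S)
    (hg : IsGloballyAsymptoticallyStable g S') : IsGloballyAsymptoticallyStable f S := by
  have h' : ∀ z, f (Φ.symm z) = Φ.symm (g z) := fun z => by
    rw [← Φ.symm_apply_apply (f (Φ.symm z)), ← h, Φ.apply_symm_apply]
  have hto : MapsTo Φ S S' := fun z hz => (hS z).2 hz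
  have hfrom : MapsTo Φ.symm S' S := fun z hz => (hS _).1 (by rwa [Φ.apply_symm_apply])
  have hS'n := hg.nonempty
  have hSn : S.Nonempty := hS'n.elim fun z hz => ⟨_, hfrom hz⟩
  have hle : ∀ z, Metric.infDist (Φ z) S' ≤
      ‖(Φ : E →L[ℝ] E')‖₊ * Metric.infDist z S :=
    infDist_image_le (Φ : E →L[ℝ] E').lipschitz hSn hto
  have hge : ∀ z, Metric.infDist z S ≤
      ‖(Φ.symm : E' →L[ℝ] E)‖₊ * Metric.infDist (Φ z) S' := fun z => by
    have := infDist_image_le (Φ.symm : E' →L[ℝ] E).lipschitz hS'n hfrom (Φ z)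
    simpa using this
  have hmap : ∀ {γ : ℝ → E} {I : Set ℝ}, IsSolutionOn f γ I → IsSolutionOn g (fun t => Φ (γ t)) I :=
    fun hγ => hγ.map (Φ : E →L[ℝ] E') h
  have hmap' : ∀ {γ : ℝ → E'} {I : Set ℝ}, IsSolutionOn g γ I →
      IsSolutionOn f (fun t => Φ.symm (γ t)) I :=
    fun hγ => hγ.map (Φ.symm : E' →L[ℝ] E) h'
  refine ⟨hSn, fun z => ?_, fun T γ hT hγ => ?_, fun ε hε => ?_, fun γ hγ => ?_⟩
  · obtain ⟨γ, h0, hγ⟩ := hg.exists_solution (Φ z)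
    exact ⟨_, by simp [h0], hmap' hγ⟩
  · obtain ⟨γ', hγ', heq⟩ := hg.extends_forever T _ hT (hmap hγ)
    exact ⟨_, hmap' hγ', fun t ht => by simp [heq ht]⟩
  · set K : NNReal := ‖(Φ : E →L[ℝ] E')‖₊
    set L : NNReal := ‖(Φ.symm : E' →L[ℝ] E)‖₊
    have hK : (0 : ℝ) < K + 1 := by positivity
    have hL : (0 : ℝ) < L + 1 := by positivity
    obtain ⟨δ, hδ, hst⟩ := hg.stable (ε / (L + 1)) (div_pos hε hL)
    refine ⟨δ / (K + 1), div_pos hδ hK, fun γ hγ h0 t ht => ?_⟩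
    rw [lt_div_iff₀ hK] at h0
    have h1 := hst _ (hmap hγ) ((hle _).trans_lt (by
      nlinarith [Metric.infDist_nonneg (x := γ 0) (s := S)])) t ht
    rw [lt_div_iff₀ hL] at h1
    exact (hge _).trans_lt (by nlinarith [Metric.infDist_nonneg (x := Φ (γ t)) (s := S')])
  · refine squeeze_zero (fun _ => Metric.infDist_nonneg) (fun t => hge (γ t)) ?_
    have := (hg.attractive _ (hmap hγ)).const_mul (‖(Φ.symm : E' →L[ℝ] E)‖₊ : ℝ)
    rwa [mul_zero] at this

end Transfer

/-! ### Anchored flows of monotone operators. -/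

section Monotone

variable {P : Type*} [NormedAddCommGroup P] [InnerProductSpace ℝ P]

/-- The anchored dynamics of `F` in the coordinates `(x, (b / a) r)`, in which it is dissipative. -/
def scaledField (F : P → P) (a b : ℝ) (z : WithLp 2 (P × P)) : WithLp 2 (P × P) :=
  WithLp.toLp 2 (-F z.fst - b • (b • z.fst - a • z.snd), a • (b • z.fst - a • z.snd))

/-- The anchor terms form minus the gradient of the convex quadratic `½‖b x - a s‖²`, so they
contribute minus a perfect square. -/
lemma inner_scaledField_sub (F : P → P) (a b : ℝ) (z w : WithLp 2 (P × P)) :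
    inner ℝ (scaledField F a b z - scaledField F a b w) (z - w) =
      -inner ℝ (F z.fst - F w.fst) (z.fst - w.fst) -
        ‖b • (z.fst - w.fst) - a • (z.snd - w.snd)‖ ^ 2 := by
  rw [WithLp.prod_inner_apply, ← real_inner_self_eq_norm_sq]
  have h1 : (scaledField F a b z - scaledField F a b w).fst =
      -(F z.fst - F w.fst) - b • (b • (z.fst - w.fst) - a • (z.snd - w.snd)) := by
    simp only [scaledField, WithLp.sub_fst, WithLp.toLp_fst]
    module
  have h2 : (scaledField F a b z - scaledField F a b w).snd =
      a • (b • (z.fst - w.fst) - a • (z.snd - w.snd)) := by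
    simp only [scaledField, WithLp.sub_snd, WithLp.toLp_snd]
    module
  change inner ℝ (scaledField F a b z - scaledField F a b w).fst (z - w).fst +
    inner ℝ (scaledField F a b z - scaledField F a b w).snd (z - w).snd = _
  rw [h1, h2, WithLp.sub_fst, WithLp.sub_snd]
  set d := z.fst - w.fst
  set e := z.snd - w.snd
  set u := b • d - a • e with hu
  have h3 : inner ℝ u u = b * inner ℝ u d - a * inner ℝ u e := by
    nth_rw 2 [hu]
    rw [inner_sub_right, inner_smul_right, inner_smul_right]
  rw [h3, inner_sub_left, inner_neg_left, real_inner_smul_left, real_inner_smul_left]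
  ring

lemma isDissipative_scaledField {F : P → P} (hF : IsMonotoneOperator F) (a b : ℝ) :
    IsDissipative (scaledField F a b) := fun z w => by
  rw [inner_scaledField_sub]
  linarith [hF z.fst w.fst, sq_nonneg ‖b • (z.fst - w.fst) - a • (z.snd - w.snd)‖]

lemma continuous_scaledField {F : P → P} (hF : Continuous F) (a b : ℝ) :
    Continuous (scaledField F a b) := by
  unfold scaledField
  fun_prop

lemma scaledField_eq_zero_iff {F : P → P} {a b : ℝ} (ha : a ≠ 0) {z : WithLp 2 (P × P)} :
    scaledField F a b z = 0 ↔ F z.fst = 0 ∧ b • z.fst = a • z.snd := by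
  rw [← sub_eq_zero (a := b • z.fst)]
  unfold scaledField
  rw [← WithLp.toLp_zero, (WithLp.toLp_injective 2).eq_iff, Prod.mk_eq_zero, smul_eq_zero,
    or_iff_right ha]
  refine and_congr_left fun h => ?_
  rw [h]; simp

/-- The coordinate change `(x, r) ↦ (x, c r)`. -/
def scaleEquiv (P : Type*) [NormedAddCommGroup P] [InnerProductSpace ℝ P] {c : ℝ} (hc : c ≠ 0) :
    (P × P) ≃L[ℝ] WithLp 2 (P × P) :=
  ((ContinuousLinearEquiv.refl ℝ P).prodCongr
    (ContinuousLinearEquiv.smulLeft (Units.mk0 c hc))).trans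
    (WithLp.prodContinuousLinearEquiv 2 ℝ P P).symm

lemma scaleEquiv_apply {c : ℝ} (hc : c ≠ 0) (z : P × P) :
    scaleEquiv P hc z = WithLp.toLp 2 (z.1, c • z.2) := rfl

variable [FiniteDimensional ℝ P]

theorem scaledField_isGloballyAsymptoticallyStable {F : P → P} (hF : IsMonotoneOperator F)
    (hc : Continuous F) {x₀ : P} (hx₀ : F x₀ = 0) {a b : ℝ} (ha : a ≠ 0) (hb : b ≠ 0) :
    IsGloballyAsymptoticallyStable (scaledField F a b) {z | scaledField F a b z = 0} := by
  have hz₀ : scaledField F a b (WithLp.toLp 2 (x₀, (a⁻¹ * b) • x₀)) = 0 := by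
    rw [scaledField_eq_zero_iff ha]
    exact ⟨hx₀, by simp [smul_smul, mul_inv_cancel_left₀ ha]⟩
  refine (isDissipative_scaledField hF a b).isGloballyAsymptoticallyStable
    (continuous_scaledField hc a b) hz₀ fun ζ hζ hin => ?_
  -- Two nonpositive terms sum to zero, so the square vanishes; at the equilibrium the same linear
  -- relation holds and cancels out.
  have hbal : ∀ t, 0 ≤ t → b • (ζ t).fst = a • (ζ t).snd := fun t ht => by
    have h := inner_scaledField_sub F a b (ζ t) (WithLp.toLp 2 (x₀, (a⁻¹ * b) • x₀))
    rw [hz₀, sub_zero, hin t ht] at h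
    have h1 := hF (ζ t).fst x₀
    simp only [WithLp.toLp_fst, WithLp.toLp_snd] at h
    have h2 : ‖b • ((ζ t).fst - x₀) - a • ((ζ t).snd - (a⁻¹ * b) • x₀)‖ ^ 2 = 0 :=
      le_antisymm (by linarith) (sq_nonneg _)
    rw [sq_eq_zero_iff, norm_eq_zero, smul_sub, smul_sub, smul_smul a,
      mul_inv_cancel_left₀ ha, sub_sub_sub_cancel_right, sub_eq_zero] at h2
    exact h2
  have hfst : ∀ t ∈ Ici (0 : ℝ), HasDerivWithinAt (fun t => (ζ t).fst) (-F (ζ t).fst) (Ici 0) t :=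
    fun t ht => by
      have h : (scaledField F a b (ζ t)).fst = -F (ζ t).fst := by simp [scaledField, hbal t ht]
      rw [← h]
      exact (WithLp.fstL 2 ℝ P P).hasFDerivAt.comp_hasDerivWithinAt t (hζ t ht)
  have hsnd : ∀ t ∈ Ici (0 : ℝ), HasDerivWithinAt (fun t => (ζ t).snd) 0 (Ici 0) t :=
    fun t ht => by
      have h : (scaledField F a b (ζ t)).snd = 0 := by simp [scaledField, hbal t ht]
      rw [← h]
      exact (WithLp.sndL 2 ℝ P P).hasFDerivAt.comp_hasDerivWithinAt t (hζ t ht)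
  have hx : ∀ t, 0 ≤ t → (ζ t).fst = (b⁻¹ * a) • (ζ t).snd := fun t ht => by
    rw [← smul_smul, ← hbal t ht, inv_smul_smul₀ hb]
  have h0 : (0 : ℝ) ∈ Ici (0 : ℝ) := mem_Ici.2 le_rfl
  -- Being a multiple of the second component, `x` has derivative 0; it also has derivative `-F x`,
  -- so `F x = 0`.
  have hfst' : HasDerivWithinAt (fun t => (ζ t).fst) 0 (Ici 0) 0 := by
    have := ((hsnd 0 h0).const_smul (b⁻¹ * a)).congr (fun t ht => hx t ht) (hx 0 le_rfl)
    rwa [smul_zero] at this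
  have hF0 := (uniqueDiffOn_Ici (0 : ℝ) 0 h0).eq_deriv _ (hfst 0 h0) hfst'
  exact (scaledField_eq_zero_iff ha).2 ⟨neg_eq_zero.1 hF0, hbal 0 le_rfl⟩

/-- Adding the anchor `r` to the flow of a continuous monotone operator with a zero makes the zero
set globally asymptotically stable. -/
theorem anchored_isGloballyAsymptoticallyStable {F : P → P} (hF : IsMonotoneOperator F)
    (hc : Continuous F) {x₀ : P} (hx₀ : F x₀ = 0) {α β : ℝ} (hα : 0 < α) (hβ : 0 < β) :
    IsGloballyAsymptoticallyStable
      (fun z : P × P => (-F z.1 - β • (z.1 - z.2), α • (z.1 - z.2)))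
      {z | ∃ x, F x = 0 ∧ z = (x, x)} := by
  have ha : √α ≠ 0 := (Real.sqrt_pos.2 hα).ne'
  have hb : √β ≠ 0 := (Real.sqrt_pos.2 hβ).ne'
  have hαs : √α * √α = α := Real.mul_self_sqrt hα.le
  have hβs : √β * √β = β := Real.mul_self_sqrt hβ.le
  -- With `a = √α`, `b = √β` and `s = (√β / √α) r`, one gets `b x - a s = √β (x - r)`, which
  -- reproduces both the `β` and the `α` term.
  have hac : √α * (√β / √α) = √β := mul_div_cancel₀ _ ha
  refine (scaledField_isGloballyAsymptoticallyStable hF hc hx₀ ha hb).of_conj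
    (scaleEquiv P (div_ne_zero hb ha)) (fun z => ?_) fun z => ?_
  · have hcα : √β / √α * α = √α * √β := by
      nth_rw 2 [← hαs]; field_simp
    simp only [scaleEquiv_apply, scaledField, WithLp.toLp_fst, WithLp.toLp_snd, smul_smul, hac,
      hcα, ← smul_sub, hβs]
  · rw [mem_ofPred_eq, scaledField_eq_zero_iff ha]
    simp only [scaleEquiv_apply, WithLp.toLp_fst, WithLp.toLp_snd, smul_smul, hac, mem_ofPred_eq]
    constructor
    · rintro ⟨h1, h2⟩
      exact ⟨z.1, h1, Prod.ext rfl (smul_right_injective P hb h2).symm⟩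
    · rintro ⟨x, h1, rfl⟩
      exact ⟨h1, rfl⟩

end Monotone

/-! ### Nash equilibria as zeros of the pseudo-gradient. -/

section Game

variable {N : ℕ} {n : Fin N → ℕ}

/-- The inclusion of player `i`'s action space into the profile space. -/
def singleL (n : Fin N → ℕ) (i : Fin N) : EuclideanSpace ℝ (Fin (n i)) →L[ℝ] Profile n :=
  (PiLp.continuousLinearEquiv 2 ℝ
    fun i : Fin N => EuclideanSpace ℝ (Fin (n i))).symm.toContinuousLinearMap ∘L
    ContinuousLinearMap.single ℝ (fun i : Fin N => EuclideanSpace ℝ (Fin (n i))) i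

lemma deviate_self (x : Profile n) (i : Fin N) : deviate x i (x i) = x := by
  simp [deviate]

lemma deviate_eq (x : Profile n) (i : Fin N) (y : EuclideanSpace ℝ (Fin (n i))) :
    deviate x i y = x + singleL n i (y - x i) := by
  ext j : 1
  rcases eq_or_ne j i with rfl | h
  · simp [deviate, singleL]
  · simp [deviate, singleL, h]

lemma hasFDerivAt_deviate (x : Profile n) (i : Fin N) (y : EuclideanSpace ℝ (Fin (n i))) :
    HasFDerivAt (deviate x i) (singleL n i) y := by
  have h : deviate x i = fun y => x + singleL n i (y - x i) := funext (deviate_eq x i)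
  rw [h]
  exact ((singleL n i).hasFDerivAt.comp y ((hasFDerivAt_id y).sub_const (x i))).const_add x

variable {J : Fin N → Profile n → ℝ}

lemma IsRegularGame.hasFDerivAt_cost (hJ : IsRegularGame J) (x : Profile n) (i : Fin N) :
    HasFDerivAt (fun y => J i (deviate x i y)) (fderiv ℝ (J i) x ∘L singleL n i) (x i) := by
  have h : HasFDerivAt (J i) (fderiv ℝ (J i) x) (deviate x i (x i)) := by
    rw [deviate_self]
    exact ((hJ.contDiff i).differentiable one_ne_zero x).hasFDerivAt
  exact h.comp (x i) (hasFDerivAt_deviate x i (x i))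

lemma IsRegularGame.pseudoGradient_apply (hJ : IsRegularGame J) (x : Profile n) (i : Fin N) :
    pseudoGradient J x i =
      (InnerProductSpace.toDual ℝ _).symm (fderiv ℝ (J i) x ∘L singleL n i) := by
  change gradient (fun y => J i (deviate x i y)) (x i) = _
  rw [gradient, (hJ.hasFDerivAt_cost x i).fderiv]

lemma IsRegularGame.continuous_pseudoGradient (hJ : IsRegularGame J) :
    Continuous (pseudoGradient J) := by
  refine (PiLp.continuous_toLp 2 _).comp (continuous_pi fun i => ?_)
  change Continuous fun x => pseudoGradient J x i
  simp only [hJ.pseudoGradient_apply]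
  exact (InnerProductSpace.toDual ℝ _).symm.continuous.comp
    (((hJ.contDiff i).continuous_fderiv one_ne_zero).clm_comp continuous_const)

/-- One direction is Fermat's rule in each player's own variable. For the other, the cost restricted
to the segment from `x i` to `y` is convex with derivative 0 at the start, so its slope over `[0,
1]` is nonnegative. -/
lemma IsRegularGame.isNashEquilibrium_iff (hJ : IsRegularGame J) (x : Profile n) :
    IsNashEquilibrium J x ↔ pseudoGradient J x = 0 := by
  have hgrad : pseudoGradient J x = 0 ↔ ∀ i, fderiv ℝ (J i) x ∘L singleL n i = 0 := by
    rw [PiLp.ext_iff]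
    refine forall_congr' fun i => ?_
    rw [hJ.pseudoGradient_apply, PiLp.zero_apply, map_eq_zero_iff]
    exact (InnerProductSpace.toDual ℝ _).symm.injective
  rw [hgrad]
  refine forall_congr' fun i => ⟨fun h => ?_, fun h y => ?_⟩
  · have hmin : IsLocalMin (fun y => J i (deviate x i y)) (x i) :=
      Eventually.of_forall fun y => by simpa only [deviate_self] using h y
    exact hmin.hasFDerivAt_eq_zero (hJ.hasFDerivAt_cost x i)
  · set φ : EuclideanSpace ℝ (Fin (n i)) → ℝ := fun y => J i (deviate x i y) with hφ
    have hd : HasFDerivAt φ (0 : _ →L[ℝ] ℝ) (x i) := h ▸ hJ.hasFDerivAt_cost x i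
    let l : ℝ → EuclideanSpace ℝ (Fin (n i)) := AffineMap.lineMap (x i) y
    have hconv : ConvexOn ℝ univ (φ ∘ l) := by
      simpa using (hJ.convex i x).comp_affineMap (AffineMap.lineMap (x i) y)
    have hl0 : l 0 = x i := AffineMap.lineMap_apply_zero _ _
    have hderiv : HasDerivAt (φ ∘ l) 0 0 := by
      have hd' : HasFDerivAt φ (0 : _ →L[ℝ] ℝ) (l 0) := hl0.symm ▸ hd
      have := hd'.comp_hasDerivAt (0 : ℝ) (AffineMap.hasDerivAt_lineMap (a := x i) (b := y))
      simpa using this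
    have hs := hconv.le_slope_of_hasDerivAt (mem_univ 0) (mem_univ 1) zero_lt_one hderiv
    have hl1 : l 1 = y := AffineMap.lineMap_apply_one _ _
    simp only [slope_def_field, Function.comp, hl0, hl1, sub_zero, div_one, hφ, deviate_self] at hs
    linarith

end Game

end HeavyAnchor

end

theorem theorem1 {N : ℕ} {n : Fin N → ℕ} (J : Fin N → HeavyAnchor.Profile n → ℝ)
    (hJ : HeavyAnchor.IsRegularGame J)
    (hF : HeavyAnchor.IsMonotoneOperator (HeavyAnchor.pseudoGradient J))
    (hNE : ∃ x, HeavyAnchor.IsNashEquilibrium J x)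
    (α β : ℝ) (hα : 0 < α) (hβ : 0 < β) :
    {x | HeavyAnchor.IsNashEquilibrium J x} = {x | HeavyAnchor.pseudoGradient J x = 0} ∧
    HeavyAnchor.IsGloballyAsymptoticallyStable (HeavyAnchor.vectorField J α β)
      {z | ∃ x, HeavyAnchor.pseudoGradient J x = 0 ∧ z = (x, x)} := by
  obtain ⟨x₀, hx₀⟩ := hNE
  exact ⟨Set.ext fun x => hJ.isNashEquilibrium_iff x,
    HeavyAnchor.anchored_isGloballyAsymptoticallyStable hF hJ.continuous_pseudoGradient
      ((hJ.isNashEquilibrium_iff x₀).1 hx₀) hα hβ⟩
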